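/- Let $G$ be a locally compact group and $X\subset G$ any subset. Unitary representations of $G$ are on complex Hilbert spaces and are strongly continuous. A positive definite function on $G$ is $\varphi:G\to\mathbf C$ with $\varphi(g)=\overline{\varphi(g^{-1})}$ and $\sum_{i,j}c_i\overline{c_j}\varphi(g_i^{-1}g_j)\ge 0$ for all $n$, $g_i\in G$, $c_i\in\mathbf C$ ($1\le i\le n$); it is normalized if $\varphi(1)=1$. A conditionally negative definite function on $G$ is $\psi:G\to\mathbf R$ with $\psi(1)=0$, $\psi(g)=\psi(g^{-1})$ and $\sum_{i,j}c_ic_j\psi(g_i^{-1}g_j)\le 0$ for all $n$, $g_i\in G$, $c_i\in\mathbf R$ ($1\le i\le n$) with $\sum_i c_i=0$. For $W\subset G$ and $\varepsilon\ge 0$, a $(W,\varepsilon)$-invariant vector of a unitary representation $\pi$ is a nonzero vector $\xi$ with $\|\pi(g)\xi-\xi\|\le\varepsilon\|\xi\|$ for all $g\in W$; $\pi$ almost has invariant vectors ($1\prec\pi$) if it has a $(K,\varepsilon)$-invariant vector for every compact $K\subset G$ and every $\varepsilon>0$. For $\varepsilon>0$, a subset $W\subset G$ is an $\varepsilon$-Kazhdan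 subset for $(G,X)$ if there is $\eta>0$ such that every unitary representation of $G$ with a $(W,\eta)$-invariant vector has an $(X,\varepsilon)$-invariant vector. Consider the following properties. (1) $(G,X)$ has relative Property (T): every net of continuous normalized positive definite functions on $G$ that converges to $1$ uniformly on compact subsets converges to $1$ uniformly on $X$. (2) For every $\varepsilon>0$ there is a compact $\varepsilon$-Kazhdan subset for $(G,X)$. (2') For some $\varepsilon$ with $0<\varepsilon<\sqrt2$ there is a compact $\varepsilon$-Kazhdan subset for $(G,X)$. (3) For every $\varepsilon>0$, every unitary representation $\pi$ of $G$ with $1\prec\pi$ has an $(X,\varepsilon)$-invariant vector. (3') There is $\varepsilon$ with $0\le\varepsilon<\sqrt2$ such that every unitary representation $\pi$ of $G$ with $1\prec\pi$ has an $(X,\varepsilon)$-invariant vector. (4) $(G,X)$ has relative Property (FH): every continuous conditionally negative definite function on $G$ is bounded on $X$; equivalently, for every continuous affine isometric action of $G$ on an affine Hilbert space $\mathscr H$ and every $v\in\mathscr H$, the set $Xv$ is bounded. Then (1)$\Rightarrow$(2), (2)$\Rightarrow$(2'), (2)$\Rightarrow$(3), (2')$\Rightarrow$(3'), (3)$\Rightarrow$(3')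 and (3')$\Rightarrow$(4), and the two formulations of (4) are equivalent. Moreover, if $G$ is $\sigma$-compact, then (4)$\Rightarrow$(1), so that all these properties are equivalent. -/

import Mathlib

open Filter
open scoped ComplexOrder

universe u

namespace RelKazhdan

/-- Positive definite functions on a group. The inequality `0 ≤ z` in `ℂ` says that `z` is real
and nonnegative. -/
structure IsPosDefFun {G : Type u} [Group G] (φ : G → ℂ) : Prop where
  conj_inv : ∀ g : G, φ g = star (φ g⁻¹)
  sum_nonneg : ∀ (n : ℕ) (g : Fin n → G) (c : Fin n → ℂ),
    0 ≤ ∑ i, ∑ j, c i * star (c j) * φ ((g i)⁻¹ * g j)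

/-- (Real-valued) conditionally negative definite functions on a group. -/
structure IsCondNegDefFun {G : Type u} [Group G] (ψ : G → ℝ) : Prop where
  map_one : ψ 1 = 0
  map_inv : ∀ g : G, ψ g = ψ g⁻¹
  sum_nonpos : ∀ (n : ℕ) (g : Fin n → G) (c : Fin n → ℝ), ∑ i, c i = 0 →
    ∑ i, ∑ j, c i * c j * ψ ((g i)⁻¹ * g j) ≤ 0

/-- Relative Property (T) for `(G, X)`: every net (indexed by a nonempty directed preorder) of
continuous normalized positive definite functions that converges to `1` uniformly on compact
subsets converges to `1` uniformly on `X`. -/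
def RelPropT (G : Type u) [Group G] [TopologicalSpace G] (X : Set G) : Prop :=
  ∀ (ι : Type u) [Preorder ι] [IsDirectedOrder ι] [Nonempty ι] (φ : ι → G → ℂ),
    (∀ i, Continuous (φ i) ∧ IsPosDefFun (φ i) ∧ φ i 1 = 1) →
    (∀ K : Set G, IsCompact K → TendstoUniformlyOn φ (fun _ => 1) atTop K) →
    TendstoUniformlyOn φ (fun _ => 1) atTop X

/-- Relative Property (FH) for `(G, X)`: every continuous conditionally negative definite
function on `G` is bounded on `X`. -/
def RelPropFH (G : Type u) [Group G] [TopologicalSpace G] (X : Set G) : Prop :=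
  ∀ ψ : G → ℝ, Continuous ψ → IsCondNegDefFun ψ → ∃ M : ℝ, ∀ g ∈ X, |ψ g| ≤ M

/-- The formulation of relative Property (FH) with actions: for every continuous affine isometric
action of `G` on an affine Hilbert space `P` (with real Hilbert space of translations `V`), and
every `v : P`, the set `X v` is bounded. -/
def RelPropFHAffine (G : Type u) [Group G] [TopologicalSpace G] (X : Set G) : Prop :=
  ∀ (V P : Type u) [NormedAddCommGroup V] [InnerProductSpace ℝ V] [CompleteSpace V]
    [MetricSpace P] [NormedAddTorsor V P] (α : G →* (P ≃ᵃⁱ[ℝ] P)),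
    (∀ v : P, Continuous fun g : G => α g v) →
    ∀ v : P, Bornology.IsBounded ((fun g : G => α g v) '' X)

/-- (Strongly continuous) unitary representations of `G` on `H`. -/
structure UnitaryRep (G : Type u) [Group G] [TopologicalSpace G]
    (H : Type u) [NormedAddCommGroup H] [InnerProductSpace ℂ H] where
  toHom : G →* (H ≃ₗᵢ[ℂ] H)
  continuous_orbit : ∀ ξ : H, Continuous fun g : G => toHom g ξ

section

variable {G : Type u} [Group G] [TopologicalSpace G]
  {H : Type u} [NormedAddCommGroup H] [InnerProductSpace ℂ H]

/-- `π` has an `(X, ε)`-invariant vector. -/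
def HasInvVec (π : UnitaryRep G H) (X : Set G) (ε : ℝ) : Prop :=
  ∃ ξ : H, ξ ≠ 0 ∧ ∀ g ∈ X, ‖π.toHom g ξ - ξ‖ ≤ ε * ‖ξ‖

/-- `1 ≺ π`: the representation `π` almost has invariant vectors. -/
def AlmostHasInvVec (π : UnitaryRep G H) : Prop :=
  ∀ K : Set G, IsCompact K → ∀ ε : ℝ, 0 < ε → HasInvVec π K ε

end

/-- `(W, η)` is an `ε`-Kazhdan pair for `(G, X)` (meant for `ε, η > 0`). -/
def IsKazhdanPair (G : Type u) [Group G] [TopologicalSpace G] (X W : Set G) (ε η : ℝ) : Prop :=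
  ∀ (H : Type u) [NormedAddCommGroup H] [InnerProductSpace ℂ H] [CompleteSpace H]
    (π : UnitaryRep G H), HasInvVec π W η → HasInvVec π X ε

/-- `W` is an `ε`-Kazhdan subset for `(G, X)` (meant for `ε > 0`). -/
def IsKazhdanSubset (G : Type u) [Group G] [TopologicalSpace G] (X W : Set G) (ε : ℝ) : Prop :=
  ∃ η : ℝ, 0 < η ∧ IsKazhdanPair G X W ε η

/-- `G` has a compact `ε`-Kazhdan subset for `(G, X)`. -/
def HasCompactKazhdanSubset (G : Type u) [Group G] [TopologicalSpace G] (X : Set G) (ε : ℝ) :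
    Prop :=
  ∃ K : Set G, IsCompact K ∧ IsKazhdanSubset G X K ε

/-- Every unitary representation of `G` that almost has invariant vectors has an
`(X, ε)`-invariant vector. -/
def AlmostInvImpliesInv (G : Type u) [Group G] [TopologicalSpace G] (X : Set G) (ε : ℝ) : Prop :=
  ∀ (H : Type u) [NormedAddCommGroup H] [InnerProductSpace ℂ H] [CompleteSpace H]
    (π : UnitaryRep G H), AlmostHasInvVec π → HasInvVec π X ε

end RelKazhdan

/-!
The implications between the conditions rest on two constructions.

*Kernels.* An invariant positive semidefinite kernel on a `G`-set is the Gram kernel of a total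
family of vectors in a Hilbert space on which `G` acts by isometries
(`exists_representation_of_kernel`). A conditionally negative definite `ψ` gives two such kernels.
The first is the kernel `pairKernel ψ` on `G × G` of the differences `b a - b a'`, where
`ψ (g⁻¹ * h) = ‖b g - b h‖ ^ 2`; its Hilbert space carries an affine isometric action of `G` by
`v ↦ π g v + b g`, which identifies the two formulations of relative Property (FH). The second is
the orthogonal sum `expKernel ψ s` of the kernels `exp (-(s n) ^ 2 * ψ (g⁻¹ * h))`, positive
semidefinite by the Schur product theorem. If `s n → 0`, its representation almost has invariant
vectors, while `⟪η, π g ξ⟫ → 0` as `ψ g → ∞`. A unit `(X, ε)`-invariant vector `ξ` has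
`Re ⟪ξ, π g ξ⟫ ≥ 1 - ε ^ 2 / 2 > 0` for `g ∈ X` when `ε < √2`, so `ψ` is bounded on `X`
(`AlmostInvImpliesInv.relPropFH`).

*Nets and series.* If no compact set is `ε`-Kazhdan, the matrix coefficients of unit almost
invariant vectors of counterexamples form a net which tends to `1` uniformly on compact sets and not
on `X` (`RelPropT.hasCompactKazhdanSubset`). Conversely, if such a net exists and `G` is
`σ`-compact, a sequence `φ n` extracted from it converges to `1` so fast along a compact exhaustion
that `∑ 2 ^ n * (1 - Re (φ n))` is a continuous conditionally negative definite function; it is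
unbounded on `X`, since `‖φ - 1‖ ^ 2 ≤ 2 * (1 - Re φ)` for normalized positive definite `φ`
(`RelPropFH.relPropT`).
-/

open Topology Matrix
open scoped InnerProductSpace

namespace RelKazhdan

/-! ### Positive semidefinite kernels -/

section Kernel

variable {S : Type*}

theorem posSemidef_real_of_finset {M : Matrix S S ℝ} (hs : ∀ i j, M i j = M j i)
    (h : ∀ (s : Finset S) (c : S → ℝ), 0 ≤ ∑ i ∈ s, ∑ j ∈ s, c i * c j * M i j) :
    M.PosSemidef := by
  refine ⟨by ext i j; simpa using hs j i, fun x => ?_⟩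
  refine (h x.support x).trans_eq ?_
  simp only [Finsupp.sum, star_trivial]
  exact Finset.sum_congr rfl fun i _ => Finset.sum_congr rfl fun j _ => by ring

theorem posSemidef_sum_nonneg {M : Matrix S S ℝ} (h : M.PosSemidef) (s : Finset S) (c : S → ℝ) :
    0 ≤ ∑ i ∈ s, ∑ j ∈ s, c i * c j * M i j := by
  classical
  refine (h.2 (Finsupp.onFinset s (fun i => if i ∈ s then c i else 0)
    (by intro a; simp +contextual))).trans_eq ?_
  rw [Finsupp.onFinset_sum _ (by simp)]
  refine Finset.sum_congr rfl fun i hi => ?_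
  rw [Finsupp.onFinset_sum _ (by simp)]
  refine Finset.sum_congr rfl fun j hj => ?_
  simp [hi, hj]; ring

theorem posSemidef_rankOne (d : S → ℝ) : (Matrix.of fun i j => d i * d j).PosSemidef := by
  refine posSemidef_real_of_finset (fun i j => by simp [mul_comm]) fun s c => ?_
  refine (sq_nonneg (∑ i ∈ s, c i * d i)).trans_eq ?_
  rw [sq, Finset.sum_mul_sum]
  exact Finset.sum_congr rfl fun i _ => Finset.sum_congr rfl fun j _ => by simp; ring

theorem posSemidef_pow {M : Matrix S S ℝ} (h : M.PosSemidef) (m : ℕ) :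
    (Matrix.of fun i j => M i j ^ m).PosSemidef := by
  induction m with
  | zero => simpa using posSemidef_rankOne (fun _ : S => (1 : ℝ))
  | succ m ih =>
    have hM : (Matrix.of fun i j => M i j ^ (m + 1)) = (Matrix.of fun i j => M i j ^ m) ⊙ M := by
      ext i j; simp [pow_succ]
    rw [hM]
    exact ih.hadamard h

/-- By the Schur product theorem, the entrywise exponential of a positive semidefinite kernel is
positive semidefinite. -/
theorem posSemidef_exp {M : Matrix S S ℝ} (h : M.PosSemidef) :
    (Matrix.of fun i j => Real.exp (M i j)).PosSemidef := by
  have hs : ∀ i j, M i j = M j i := fun i j => by simpa using (h.1.apply i j).symm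
  refine posSemidef_real_of_finset (fun i j => by simp [hs i j]) fun s c => ?_
  have key : HasSum (fun m : ℕ => ∑ i ∈ s, ∑ j ∈ s, c i * c j * (M i j ^ m / (m.factorial : ℝ)))
      (∑ i ∈ s, ∑ j ∈ s, c i * c j * Real.exp (M i j)) := by
    refine hasSum_sum fun i _ => hasSum_sum fun j _ => HasSum.mul_left _ ?_
    rw [Real.exp_eq_exp_ℝ]
    exact NormedSpace.expSeries_div_hasSum_exp (M i j)
  refine key.nonneg fun m => ?_
  have := div_nonneg (posSemidef_sum_nonneg (posSemidef_pow h m) s c)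
    (m.factorial.cast_nonneg (α := ℝ))
  refine this.trans_eq ?_
  simp only [Finset.sum_div, Matrix.of_apply, mul_div_assoc]

theorem posSemidef_ofReal {M : Matrix S S ℝ} (h : M.PosSemidef) :
    (M.map ((↑) : ℝ → ℂ)).PosSemidef := by
  have hs : ∀ i j, M i j = M j i := fun i j => by simpa using (h.1.apply i j).symm
  have hH : (M.map ((↑) : ℝ → ℂ)).IsHermitian := by ext i j; simp [hs i j]
  refine ⟨hH, fun x => ?_⟩
  rw [Complex.nonneg_iff]
  simp only [Finsupp.sum, Complex.re_sum, Complex.im_sum]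
  constructor
  · refine (add_nonneg (posSemidef_sum_nonneg h x.support fun i => (x i).re)
      (posSemidef_sum_nonneg h x.support fun i => (x i).im)).trans_eq ?_
    simp only [← Finset.sum_add_distrib]
    exact Finset.sum_congr rfl fun i _ => Finset.sum_congr rfl fun j _ => by simp; ring
  · -- the imaginary part is antisymmetric in the two summation indices
    rw [eq_comm, ← self_eq_neg, ← Finset.sum_neg_distrib, Finset.sum_comm]
    refine Finset.sum_congr rfl fun i _ => ?_
    rw [← Finset.sum_neg_distrib]
    exact Finset.sum_congr rfl fun j _ => by simp [hs i j]; ring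

end Kernel

/-! ### Positive and conditionally negative definite functions -/

section CondNegDef

variable {G : Type u} [Group G] {ψ : G → ℝ}

theorem IsCondNegDefFun.sum_finset_nonpos (h : IsCondNegDefFun ψ) {ι : Type*} (s : Finset ι)
    (g : ι → G) (c : ι → ℝ) (hc : ∑ i ∈ s, c i = 0) :
    ∑ i ∈ s, ∑ j ∈ s, c i * c j * ψ ((g i)⁻¹ * g j) ≤ 0 := by
  have e := s.equivFin.symm
  have key : ∀ f : ι → ℝ, ∑ i, f (e i) = ∑ i ∈ s, f i := fun f => by
    rw [← Finset.sum_coe_sort s f]; exact Equiv.sum_comp e (fun i : s => f i)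
  have := h.sum_nonpos s.card (fun i => g (e i)) (fun i => c (e i)) (by rw [key, hc])
  refine le_trans (le_of_eq ?_) this
  rw [← key]
  refine Finset.sum_congr rfl fun i _ => ?_
  rw [← key]

/-- A conditionally negative definite kernel behaves like a squared distance. -/
theorem IsCondNegDefFun.le_two_mul_add (h : IsCondNegDefFun ψ) (a b : G) :
    ψ (a * b) ≤ 2 * ψ a + 2 * ψ b := by
  -- the parallelogram identity for the point `a` and the pair `1`, `a * b`
  have := h.sum_nonpos 3 ![1, a * b, a] ![1, 1, -2] (by simp [Fin.sum_univ_three]; norm_num)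
  simp [Fin.sum_univ_three, h.map_one, mul_assoc] at this
  have h1 := h.map_inv a
  have h2 := h.map_inv b
  have h3 := h.map_inv (a * b)
  simp at h3
  linarith

theorem IsCondNegDefFun.nonneg (h : IsCondNegDefFun ψ) (a : G) : 0 ≤ ψ a := by
  have := h.le_two_mul_add a a⁻¹
  rw [mul_inv_cancel, h.map_one, ← h.map_inv a] at this
  linarith

/-- The squared displacement of a point under an affine isometric action is conditionally negative
definite. -/
theorem isCondNegDefFun_dist_sq {V P : Type*} [NormedAddCommGroup V] [InnerProductSpace ℝ V]
    [MetricSpace P] [NormedAddTorsor V P] (α : G →* (P ≃ᵃⁱ[ℝ] P)) (v : P) :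
    IsCondNegDefFun fun g => dist (α g v) v ^ 2 := by
  have key : ∀ g h, dist (α (g⁻¹ * h) v) v = dist (α g v) (α h v) := fun g h => by
    have hmul : α g (α (g⁻¹ * h) v) = α h v := by
      have := map_mul α g (g⁻¹ * h)
      rw [mul_inv_cancel_left] at this
      rw [this, AffineIsometryEquiv.coe_mul, Function.comp_apply]
    rw [← (α g).dist_map, hmul, dist_comm]
  refine ⟨by simp, fun g => ?_, fun n g c hc => ?_⟩
  · have := key g 1
    rw [mul_one, map_one, AffineIsometryEquiv.coe_one, id] at this
    simp only [this]
  · have := EuclideanGeometry.inner_weightedVSub (fun i => α (g i) v) hc (fun i => α (g i) v) hc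
    have h0 := real_inner_self_nonneg (x := Finset.univ.weightedVSub (fun i => α (g i) v) c)
    rw [this] at h0
    simp only [key, sq]
    linarith

theorem IsPosDefFun.norm_le_one {φ : G → ℂ} (h : IsPosDefFun φ) (h1 : φ 1 = 1) (g : G) :
    ‖φ g‖ ≤ 1 := by
  -- these coefficients turn the quadratic form into `1 - ‖φ g‖ ^ 2`
  have h2 := (Complex.nonneg_iff.1 (h.sum_nonneg 2 ![1, g] ![-star (φ g), 1])).1
  have h3 := h.conj_inv g
  have h4 : φ g⁻¹ = star (φ g) := by rw [h3, star_star]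
  simp [Fin.sum_univ_two, h1, h4] at h2
  have h5 : ‖φ g‖ ^ 2 = (φ g).re * (φ g).re + (φ g).im * (φ g).im := by
    rw [← Complex.normSq_eq_norm_sq, Complex.normSq_apply]
  nlinarith [norm_nonneg (φ g)]

/-- For a normalized positive definite function, the real part controls the distance to `1`. -/
theorem IsPosDefFun.norm_sub_one_sq_le {φ : G → ℂ} (h : IsPosDefFun φ) (h1 : φ 1 = 1) (g : G) :
    ‖φ g - 1‖ ^ 2 ≤ 2 * (1 - (φ g).re) := by
  have h2 := pow_le_pow_left₀ (norm_nonneg _) (h.norm_le_one h1 g) 2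
  rw [← Complex.normSq_eq_norm_sq, Complex.normSq_apply] at h2 ⊢
  simp only [Complex.sub_re, Complex.sub_im, Complex.one_re, Complex.one_im]
  nlinarith

theorem IsPosDefFun.isCondNegDefFun {φ : G → ℂ} (h : IsPosDefFun φ) (h1 : φ 1 = 1) :
    IsCondNegDefFun fun g => 1 - (φ g).re := by
  refine ⟨by simp [h1], fun g => by rw [h.conj_inv g]; simp, fun n g c hc => ?_⟩
  have h2 := (Complex.nonneg_iff.1 (h.sum_nonneg n g fun i => c i)).1
  have h3 : ∑ i, ∑ j, c i * c j = 0 := by rw [← Finset.sum_mul_sum, hc, zero_mul]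
  simp only [mul_sub, mul_one, Finset.sum_sub_distrib, h3]
  simp [Complex.re_sum] at h2
  linarith

theorem IsCondNegDefFun.of_hasSum {f : ℕ → G → ℝ} {ψ : G → ℝ} (hf : ∀ n, IsCondNegDefFun (f n))
    (h : ∀ g, HasSum (fun n => f n g) (ψ g)) : IsCondNegDefFun ψ := by
  refine ⟨(h 1).unique (by simpa only [(hf _).map_one] using hasSum_zero), fun g => ?_,
    fun n g c hc => ?_⟩
  · refine (h g).unique ?_
    simpa only [← (hf _).map_inv g] using h g⁻¹
  · have : HasSum (fun m => ∑ i, ∑ j, c i * c j * f m ((g i)⁻¹ * g j))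
        (∑ i, ∑ j, c i * c j * ψ ((g i)⁻¹ * g j)) :=
      hasSum_sum fun i _ => hasSum_sum fun j _ => (h _).mul_left _
    exact this.nonpos fun m => (hf m).sum_nonpos n g c hc

theorem IsCondNegDefFun.const_mul {ψ : G → ℝ} (h : IsCondNegDefFun ψ) {r : ℝ} (hr : 0 ≤ r) :
    IsCondNegDefFun fun g => r * ψ g := by
  refine ⟨by simp [h.map_one], fun g => by rw [h.map_inv g], fun n g c hc => ?_⟩
  refine le_trans (le_of_eq ?_) (mul_nonpos_of_nonneg_of_nonpos hr (h.sum_nonpos n g c hc))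
  simp only [Finset.mul_sum]
  exact Finset.sum_congr rfl fun i _ => Finset.sum_congr rfl fun j _ => by ring

/-- The kernel `⟪b a - b a', b c - b c'⟫` on pairs `(a, a')`, `(c, c')`, where `b` stands for a map
of `G` to a Hilbert space with `ψ (g⁻¹ * h) = ‖b g - b h‖ ^ 2`. -/
noncomputable def pairKernel (ψ : G → ℝ) : Matrix (G × G) (G × G) ℝ :=
  Matrix.of fun p q => (ψ (p.1⁻¹ * q.2) + ψ (p.2⁻¹ * q.1) - ψ (p.1⁻¹ * q.1) - ψ (p.2⁻¹ * q.2)) / 2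

theorem IsCondNegDefFun.map_inv_mul_comm (h : IsCondNegDefFun ψ) (a b : G) :
    ψ (a⁻¹ * b) = ψ (b⁻¹ * a) := by
  rw [h.map_inv]; simp

theorem posSemidef_pairKernel (h : IsCondNegDefFun ψ) : (pairKernel ψ).PosSemidef := by
  have comm := h.map_inv_mul_comm
  refine posSemidef_real_of_finset (fun p q => ?_) fun s c => ?_
  · simp only [pairKernel, Matrix.of_apply]
    rw [comm p.1, comm p.2, comm p.1 q.1, comm p.2 q.2]; ring
  · -- a pair `(a, a')` of weight `c` stands for the point masses `c` at `a` and `-c` at `a'`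
    have := h.sum_finset_nonpos (s.disjSum s) (Sum.elim Prod.fst Prod.snd)
      (Sum.elim c (fun p => - c p)) (by simp [Finset.sum_disjSum])
    simp only [Finset.sum_disjSum, Sum.elim_inl, Sum.elim_inr, ← Finset.sum_add_distrib] at this
    have h2 : ∑ i ∈ s, ∑ j ∈ s, c i * c j * pairKernel ψ i j = -(1 / 2) *
      ∑ x ∈ s, ∑ y ∈ s, (c x * c y * ψ (x.1⁻¹ * y.1) + c x * -c y * ψ (x.1⁻¹ * y.2) +
        (-c x * c y * ψ (x.2⁻¹ * y.1) + -c x * -c y * ψ (x.2⁻¹ * y.2))) := by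
      simp only [Finset.mul_sum]
      exact Finset.sum_congr rfl fun i _ => Finset.sum_congr rfl fun j _ => by
        simp only [pairKernel, Matrix.of_apply]; ring
    rw [h2]
    simp only [Finset.sum_add_distrib] at this ⊢
    linarith

/-- The orthogonal sum over `n : ℕ` of the kernels `exp (-(s n)² ψ (g⁻¹ h))` on `G`. -/
noncomputable def expKernel (ψ : G → ℝ) (s : ℕ → ℝ) :
    Matrix (Σ _ : ℕ, G) (Σ _ : ℕ, G) ℝ :=
  Matrix.of fun p q => if p.1 = q.1 then Real.exp (-(s p.1 ^ 2 * ψ (p.2⁻¹ * q.2))) else 0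

/-- Schoenberg's theorem: with `N` the Gram kernel of `ψ` based at `1`, the kernel is the product
of `exp (2 s_p s_q N)` with a rank one kernel and the diagonal in `ℕ`. -/
theorem posSemidef_expKernel (h : IsCondNegDefFun ψ) (s : ℕ → ℝ) :
    (expKernel ψ s).PosSemidef := by
  have hN := (posSemidef_pairKernel h).submatrix (fun p : Σ _ : ℕ, G => (p.2, (1 : G)))
  have h1 := posSemidef_exp
    ((posSemidef_rankOne (fun p : Σ _ : ℕ, G => s p.1)).hadamard (hN.add hN))
  have h2 := h1.hadamard
    (posSemidef_rankOne (fun p : Σ _ : ℕ, G => Real.exp (-(s p.1 ^ 2 * ψ p.2))))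
  have h3 := h2.hadamard ((PosSemidef.one (n := ℕ) (R := ℝ)).submatrix
    (fun p : Σ _ : ℕ, G => p.1))
  refine (congrArg Matrix.PosSemidef ?_).mpr h3
  ext ⟨n, g⟩ ⟨m, k⟩
  simp only [expKernel, Matrix.of_apply, Matrix.hadamard_apply, Matrix.add_apply,
    Matrix.submatrix_apply, Matrix.one_apply, pairKernel]
  split_ifs with hnm
  · subst hnm
    rw [← Real.exp_add, ← Real.exp_add, mul_one]
    congr 1
    simp only [mul_one, inv_one, one_mul, h.map_one, ← h.map_inv g]
    ring
  · simp

end CondNegDef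

end RelKazhdan

namespace RelKazhdan

/-! ### Hilbert spaces from kernels -/

section GNS

variable {𝕜 : Type} [RCLike 𝕜] {S : Type u}

/-- If a uniformly bounded family of linear maps tends to `0` on a total set, then it tends to `0`
everywhere. -/
theorem tendsto_zero_of_total {H W ι : Type*} [NormedAddCommGroup H] [NormedSpace 𝕜 H]
    [NormedAddCommGroup W] [NormedSpace 𝕜 W] {e : S → H}
    (he : Dense (Submodule.span 𝕜 (Set.range e) : Set H)) {l : Filter ι} (F : ι → H →ₗ[𝕜] W)
    (C : ℝ) (hC : ∀ i ξ, ‖F i ξ‖ ≤ C * ‖ξ‖) (h : ∀ x, Tendsto (fun i => F i (e x)) l (𝓝 0))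
    (ξ : H) : Tendsto (fun i => F i ξ) l (𝓝 0) := by
  have hspan : ∀ η ∈ Submodule.span 𝕜 (Set.range e), Tendsto (fun i => F i η) l (𝓝 0) := by
    intro η hη
    induction hη using Submodule.span_induction with
    | mem η hη => obtain ⟨x, rfl⟩ := hη; exact h x
    | zero => simpa using tendsto_const_nhds
    | add a b _ _ ha hb => simpa using ha.add hb
    | smul c a _ ha => simpa using ha.const_smul c
  rw [Metric.tendsto_nhds]
  intro ε hε
  have hC' : 0 < |C| + 1 := by positivity
  obtain ⟨η, hη, hd⟩ := he.exists_dist_lt ξ (show 0 < ε / 2 / (|C| + 1) by positivity)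
  filter_upwards [(Metric.tendsto_nhds.1 (hspan η hη)) (ε / 2) (by positivity)] with i hi
  rw [dist_zero_right] at hi ⊢
  rw [dist_eq_norm, lt_div_iff₀ hC'] at hd
  have h1 : ‖F i (ξ - η)‖ ≤ ‖ξ - η‖ * (|C| + 1) := (hC i _).trans (by
    rw [mul_comm]; gcongr; linarith [le_abs_self C])
  calc ‖F i ξ‖ = ‖F i (ξ - η) + F i η‖ := by rw [map_sub, sub_add_cancel]
    _ ≤ ‖F i (ξ - η)‖ + ‖F i η‖ := norm_add_le _ _
    _ < ε := by linarith

/-- A positive semidefinite kernel defines a semi-inner product on finitely supported functions. -/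
@[reducible] noncomputable def kernelCore {M : Matrix S S 𝕜} (hM : M.PosSemidef) :
    PreInnerProductSpace.Core 𝕜 (S →₀ 𝕜) where
  inner f g := f.sum fun x z => g.sum fun y w => star z * M x y * w
  conj_inner_symm f g := by
    rw [Finsupp.sum_comm]
    simp only [map_finsuppSum]
    congr! 4 with x z
    ext y w
    rw [← hM.1.apply x y]
    simp [mul_comm, mul_left_comm]
  add_left _ _ _ := by
    rw [Finsupp.sum_add_index'] <;> simp [← Finsupp.sum_add, add_mul]
  smul_left _ _ _ := by
    rw [Finsupp.sum_smul_index] <;> simp [Finsupp.mul_sum, ← mul_assoc]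
  re_inner_nonneg f := (RCLike.nonneg_iff.1 (hM.2 f)).1

/-- Every positive semidefinite kernel is the Gram kernel of a total family in a Hilbert space. -/
theorem exists_hilbert_of_kernel {M : Matrix S S 𝕜} (hM : M.PosSemidef) :
    ∃ (H : Type u) (_ : NormedAddCommGroup H) (_ : InnerProductSpace 𝕜 H) (_ : CompleteSpace H)
      (e : S → H), Dense (Submodule.span 𝕜 (Set.range e) : Set H) ∧
        ∀ x y, ⟪e x, e y⟫_𝕜 = M x y := by
  let core : PreInnerProductSpace.Core 𝕜 (S →₀ 𝕜) := kernelCore hM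
  let : SeminormedAddCommGroup (S →₀ 𝕜) :=
    InnerProductSpace.Core.toSeminormedAddCommGroup (𝕜 := 𝕜)
  let : InnerProductSpace 𝕜 (S →₀ 𝕜) := .ofCore _
  have hinner : ∀ f g : S →₀ 𝕜,
    ⟪f, g⟫_𝕜 = f.sum fun x z => g.sum fun y w => star z * M x y * w := fun _ _ => rfl
  let ι : (S →₀ 𝕜) →ₗᵢ[𝕜] UniformSpace.Completion (S →₀ 𝕜) := UniformSpace.Completion.toComplₗᵢ
  refine ⟨UniformSpace.Completion (S →₀ 𝕜), inferInstance, inferInstance, inferInstance,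
    fun x => ι (Finsupp.single x 1), ?_, fun x y => ?_⟩
  · have hd : DenseRange ι := UniformSpace.Completion.denseRange_coe
    refine hd.mono ?_
    rintro _ ⟨f, rfl⟩
    have hf : f = f.sum fun x c => c • Finsupp.single x (1 : 𝕜) := by
      simp
    rw [SetLike.mem_coe, hf, Finsupp.sum, map_sum]
    refine Submodule.sum_mem _ fun x _ => ?_
    rw [map_smul]
    exact Submodule.smul_mem _ _ (Submodule.subset_span ⟨x, rfl⟩)
  · rw [LinearIsometry.inner_map_map, hinner]
    simp

/-- Two families with the same Gram kernel, the first one total, are related by an isometry. -/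
theorem exists_isometry_of_gram {H F : Type*} [NormedAddCommGroup H] [InnerProductSpace 𝕜 H]
    [NormedAddCommGroup F] [InnerProductSpace 𝕜 F] [CompleteSpace F] {e : S → H} {e' : S → F}
    (he : Dense (Submodule.span 𝕜 (Set.range e) : Set H))
    (h : ∀ x y, ⟪e x, e y⟫_𝕜 = ⟪e' x, e' y⟫_𝕜) :
    ∃ U : H →ₗᵢ[𝕜] F, ∀ x, U (e x) = e' x := by
  set L := Finsupp.linearCombination 𝕜 e
  set L' := Finsupp.linearCombination 𝕜 e'
  have hd : DenseRange L := by
    rw [DenseRange, ← LinearMap.coe_range, Finsupp.range_linearCombination]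
    exact he
  have hn : ∀ f, ‖L' f‖ = ‖L f‖ := fun f => by
    have : ⟪L f, L f⟫_𝕜 = ⟪L' f, L' f⟫_𝕜 := by
      simp only [L, L', Finsupp.linearCombination_apply, Finsupp.sum, sum_inner, inner_sum,
        inner_smul_left, inner_smul_right, h]
    rw [@norm_eq_sqrt_re_inner 𝕜, @norm_eq_sqrt_re_inner 𝕜, this]
  have hb : ∃ C, ∀ f, ‖L' f‖ ≤ C * ‖L f‖ := ⟨1, fun f => by rw [hn, one_mul]⟩
  have hU := LinearMap.extendOfNorm_eq (f := L') (e := L) hd hb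
  refine ⟨⟨(L'.extendOfNorm L).toLinearMap, fun ξ => ?_⟩, fun x => ?_⟩
  · refine hd.induction_on (p := fun ξ => ‖L'.extendOfNorm L ξ‖ = ‖ξ‖) ξ
      (isClosed_eq (by fun_prop) (by fun_prop)) fun f => ?_
    rw [hU, hn]
  · have := hU (Finsupp.single x 1)
    simpa [L, L'] using this

theorem linearIsometry_ext_of_total {H F : Type*} [NormedAddCommGroup H] [InnerProductSpace 𝕜 H]
    [NormedAddCommGroup F] [InnerProductSpace 𝕜 F] {e : S → H}
    (he : Dense (Submodule.span 𝕜 (Set.range e) : Set H)) {U V : H →ₗᵢ[𝕜] F}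
    (h : ∀ x, U (e x) = V (e x)) : U = V := by
  have : U.toContinuousLinearMap = V.toContinuousLinearMap :=
    ContinuousLinearMap.ext_on he (by rintro _ ⟨x, rfl⟩; exact h x)
  ext ξ
  exact congrArg (fun T : H →L[𝕜] F => T ξ) this

variable {G : Type u} [Group G] [MulAction G S]

/-- Strong continuity of a representation can be checked on a total family, where it amounts to
continuity of matrix coefficients. -/
theorem continuous_orbit_of_total [TopologicalSpace G] {H : Type*} [NormedAddCommGroup H]
    [InnerProductSpace 𝕜 H] {e : S → H} {π : G →* (H ≃ₗᵢ[𝕜] H)}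
    (he : Dense (Submodule.span 𝕜 (Set.range e) : Set H))
    (hπ : ∀ g x, π g (e x) = e (g • x))
    (hc : ∀ x y, Continuous fun g : G => ⟪e y, e (g • x)⟫_𝕜) (ξ : H) : Continuous fun g => π g ξ := by
  rw [continuous_iff_continuousAt]
  intro g₀
  rw [ContinuousAt, ← tendsto_sub_nhds_zero_iff]
  refine tendsto_zero_of_total he
    (fun g => (π g).toLinearEquiv.toLinearMap - (π g₀).toLinearEquiv.toLinearMap) 2
    (fun g ξ => ?_) (fun x => ?_) ξ
  · refine (norm_sub_le _ _).trans_eq ?_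
    simp [two_mul]
  · have h1 : ∀ g, ‖π g (e x) - π g₀ (e x)‖ ^ 2
        = 2 * ‖e x‖ ^ 2 - 2 * RCLike.re ⟪e (g₀ • x), e (g • x)⟫_𝕜 := fun g => by
      rw [← hπ g, ← hπ g₀, @norm_sub_sq 𝕜, inner_re_symm]
      simp; ring
    have h2 : Tendsto (fun g => ‖π g (e x) - π g₀ (e x)‖ ^ 2) (𝓝 g₀)
        (𝓝 (‖π g₀ (e x) - π g₀ (e x)‖ ^ 2)) := by
      simp only [h1]
      have := (hc x (g₀ • x)).tendsto g₀
      exact (((RCLike.continuous_re.tendsto _).comp this).const_mul 2).const_sub _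
    rw [sub_self, norm_zero, zero_pow two_ne_zero] at h2
    have h3 := h2.sqrt
    simp only [Real.sqrt_zero, Real.sqrt_sq (norm_nonneg _)] at h3
    rw [tendsto_zero_iff_norm_tendsto_zero]
    exact h3

/-- The Gelfand–Naimark–Segal construction for kernels: an invariant positive semidefinite kernel
on a `G`-set comes from an isometric linear representation of `G` on a Hilbert space, strongly continuous if the kernel
is separately continuous along orbits. -/
theorem exists_representation_of_kernel [TopologicalSpace G] {M : Matrix S S 𝕜} (hM : M.PosSemidef)
    (hinv : ∀ (g : G) x y, M (g • x) (g • y) = M x y)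
    (hc : ∀ x y, Continuous fun g : G => M y (g • x)) :
    ∃ (H : Type u) (_ : NormedAddCommGroup H) (_ : InnerProductSpace 𝕜 H) (_ : CompleteSpace H)
      (e : S → H) (π : G →* (H ≃ₗᵢ[𝕜] H)), Dense (Submodule.span 𝕜 (Set.range e) : Set H) ∧
        (∀ x y, ⟪e x, e y⟫_𝕜 = M x y) ∧
        (∀ g x, π g (e x) = e (g • x)) ∧ ∀ ξ, Continuous fun g => π g ξ := by
  obtain ⟨H, i1, i2, i3, e, he, hin⟩ := exists_hilbert_of_kernel hM
  have hex : ∀ g : G, ∃ U : H →ₗᵢ[𝕜] H, ∀ x, U (e x) = e (g • x) := fun g =>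
    exists_isometry_of_gram he fun x y => by rw [hin, hin, hinv]
  choose U hU using hex
  have hmul : ∀ g h, U (g * h) = (U g).comp (U h) := fun g h =>
    linearIsometry_ext_of_total he fun x => by simp [hU, mul_smul]
  have hone : U 1 = LinearIsometry.id :=
    linearIsometry_ext_of_total he fun x => by simp [hU]
  have hcancel : ∀ g h, g * h = 1 → ∀ ξ, U g (U h ξ) = ξ := fun g h hgh ξ => by
    have := hmul g h
    rw [hgh, hone] at this
    exact (congrArg (fun T : H →ₗᵢ[𝕜] H => T ξ) this).symm
  let V : G → (H ≃ₗᵢ[𝕜] H) := fun g =>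
    { toLinearEquiv :=
        { toLinearMap := (U g).toLinearMap
          invFun := U g⁻¹
          left_inv := hcancel _ _ (inv_mul_cancel g)
          right_inv := hcancel _ _ (mul_inv_cancel g) }
      norm_map' := (U g).norm_map }
  have hV : ∀ g ξ, V g ξ = U g ξ := fun _ _ => rfl
  let π : G →* (H ≃ₗᵢ[𝕜] H) := ⟨⟨V, by ext ξ; rw [hV, hone]; rfl⟩,
    fun g h => by ext ξ; rw [hV, hmul]; rfl⟩
  have hπ : ∀ g x, π g (e x) = e (g • x) := hU
  refine ⟨H, i1, i2, i3, e, π, he, hin, hπ, continuous_orbit_of_total he hπ fun x y => ?_⟩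
  simpa only [hin] using hc x y

end GNS

end RelKazhdan

namespace RelKazhdan

variable {G : Type u} [Group G] [TopologicalSpace G]

/-! ### Matrix coefficients and relative Property (T) -/

section Coefficients

variable {H : Type u} [NormedAddCommGroup H] [InnerProductSpace ℂ H]

theorem HasInvVec.exists_unit {π : UnitaryRep G H} {X : Set G} {ε : ℝ} (h : HasInvVec π X ε) :
    ∃ ξ : H, ‖ξ‖ = 1 ∧ ∀ g ∈ X, ‖π.toHom g ξ - ξ‖ ≤ ε := by
  obtain ⟨ξ, h0, hξ⟩ := h
  have hn : 0 < ‖ξ‖ := norm_pos_iff.2 h0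
  refine ⟨((‖ξ‖⁻¹ : ℝ) : ℂ) • ξ, by simp [norm_smul, hn.ne'], fun g hg => ?_⟩
  rw [map_smul, ← smul_sub, norm_smul]
  have := hξ g hg
  simp only [Complex.norm_real, norm_inv, norm_norm]
  rwa [inv_mul_le_iff₀ hn, mul_comm]

theorem UnitaryRep.norm_sub_sq (π : UnitaryRep G H) (g : G) (ξ : H) :
    ‖π.toHom g ξ - ξ‖ ^ 2 = 2 * ‖ξ‖ ^ 2 - 2 * (⟪ξ, π.toHom g ξ⟫_ℂ).re := by
  rw [@_root_.norm_sub_sq ℂ, inner_re_symm]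
  simp; ring

theorem UnitaryRep.isPosDefFun (π : UnitaryRep G H) (ξ : H) :
    IsPosDefFun fun g => ⟪ξ, π.toHom g ξ⟫_ℂ := by
  have key : ∀ g h : G, ⟪ξ, π.toHom (g⁻¹ * h) ξ⟫_ℂ = ⟪π.toHom g ξ, π.toHom h ξ⟫_ℂ := fun g h => by
    have hmul : π.toHom g (π.toHom (g⁻¹ * h) ξ) = π.toHom h ξ := by
      have := map_mul π.toHom g (g⁻¹ * h)
      rw [mul_inv_cancel_left] at this
      rw [this, LinearIsometryEquiv.coe_mul, Function.comp_apply]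
    rw [← (π.toHom g).inner_map_map, hmul]
  refine ⟨fun g => ?_, fun n g c => ?_⟩
  · have := key g 1
    rw [mul_one, map_one, LinearIsometryEquiv.coe_one, id] at this
    rw [this]
    exact (inner_conj_symm _ _).symm
  · have h : ∑ i, ∑ j, c i * star (c j) * ⟪ξ, π.toHom ((g i)⁻¹ * g j) ξ⟫_ℂ
        = ⟪∑ i, star (c i) • π.toHom (g i) ξ, ∑ i, star (c i) • π.toHom (g i) ξ⟫_ℂ := by
      rw [sum_inner]
      refine Finset.sum_congr rfl fun i _ => ?_
      rw [inner_sum]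
      refine Finset.sum_congr rfl fun j _ => ?_
      rw [inner_smul_left, inner_smul_right, key]
      simp [mul_assoc]
    rw [h, inner_self_eq_norm_sq_to_K, ← RCLike.ofReal_pow]
    exact Complex.zero_le_real.2 (sq_nonneg _)

/-- If no compact subset is Kazhdan, then coefficients of counterexamples, indexed by the compact
subset and by `η = 1 / (n + 1)`, form a net violating relative Property (T). -/
theorem RelPropT.hasCompactKazhdanSubset {X : Set G} (hT : RelPropT G X) {ε : ℝ} (hε : 0 < ε) :
    HasCompactKazhdanSubset G X ε := by
  by_contra hcon
  have hex : ∀ i : TopologicalSpace.Compacts G × ℕ, ∃ φ : G → ℂ,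
      (Continuous φ ∧ IsPosDefFun φ ∧ φ 1 = 1) ∧
      (∀ g ∈ i.1, ‖φ g - 1‖ ≤ 1 / ((i.2 : ℝ) + 1)) ∧ ∃ g ∈ X, ε ^ 2 / 2 < ‖φ g - 1‖ := by
    rintro ⟨K, n⟩
    have hK : ¬ IsKazhdanPair G X K ε (1 / ((n : ℝ) + 1)) := fun h =>
      hcon ⟨K, K.isCompact, _, by positivity, h⟩
    rw [IsKazhdanPair] at hK
    push Not at hK
    obtain ⟨H, _, _, _, π, hinv, hX⟩ := hK
    obtain ⟨ξ, h1, hξ⟩ := hinv.exists_unit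
    have hnsq : ∀ g, ‖π.toHom g ξ - ξ‖ ^ 2 ≤ 2 * ‖⟪ξ, π.toHom g ξ⟫_ℂ - 1‖ := fun g => by
      rw [π.norm_sub_sq, h1]
      have := Complex.abs_re_le_norm (⟪ξ, π.toHom g ξ⟫_ℂ - 1)
      rw [Complex.sub_re, Complex.one_re] at this
      linarith [neg_abs_le ((⟪ξ, π.toHom g ξ⟫_ℂ).re - 1)]
    have hself : ⟪ξ, ξ⟫_ℂ = 1 := by rw [inner_self_eq_norm_sq_to_K, h1]; simp
    refine ⟨fun g => ⟪ξ, π.toHom g ξ⟫_ℂ,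
      ⟨continuous_const.inner (π.continuous_orbit ξ), π.isPosDefFun ξ, by simpa only [map_one, LinearIsometryEquiv.coe_one, id] using hself⟩,
      fun g hg => ?_, ?_⟩
    · have : ⟪ξ, π.toHom g ξ⟫_ℂ - 1 = ⟪ξ, π.toHom g ξ - ξ⟫_ℂ := by rw [inner_sub_right, hself]
      rw [this]
      refine (norm_inner_le_norm _ _).trans ?_
      rw [h1, one_mul]
      exact hξ g hg
    · by_contra! hle
      refine hX ⟨ξ, norm_ne_zero_iff.1 (by rw [h1]; exact one_ne_zero), fun g hg => ?_⟩
      rw [h1, mul_one]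
      refine abs_le_of_sq_le_sq' ?_ hε.le |>.2
      linarith [hnsq g, hle g hg]
  choose φ hφ hφK hφX using hex
  have hconv := hT (TopologicalSpace.Compacts G × ℕ) φ hφ fun K hK => by
    rw [Metric.tendstoUniformlyOn_iff]
    intro δ hδ
    obtain ⟨n, hn⟩ := exists_nat_one_div_lt hδ
    refine eventually_atTop.2 ⟨(⟨K, hK⟩, n), fun i hi g hg => ?_⟩
    rw [dist_comm, dist_eq_norm]
    refine (hφK i g (hi.1 hg)).trans_lt (lt_of_le_of_lt ?_ hn)
    have : (n : ℝ) ≤ i.2 := by exact_mod_cast hi.2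
    gcongr
  rw [Metric.tendstoUniformlyOn_iff] at hconv
  obtain ⟨i, hi⟩ := (hconv (ε ^ 2 / 2) (by positivity)).exists
  obtain ⟨g, hg, hlt⟩ := hφX i
  have := hi g hg
  rw [dist_comm, dist_eq_norm] at this
  exact absurd this hlt.le.not_gt

end Coefficients

/-! ### Almost invariant vectors and relative Property (FH) -/

section FH

variable {X : Set G} {ψ : G → ℝ}

/-- For a conditionally negative definite `ψ`, the orthogonal sum of the representations attached
to `exp (-ψ / (n + 1) ^ 2)` almost has invariant vectors, and its matrix coefficients vanish
where `ψ` tends to infinity. -/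
theorem IsCondNegDefFun.exists_unitaryRep [IsTopologicalGroup G] (h : IsCondNegDefFun ψ)
    (hcont : Continuous ψ) :
    ∃ (H : Type u) (_ : NormedAddCommGroup H) (_ : InnerProductSpace ℂ H) (_ : CompleteSpace H)
      (π : UnitaryRep G H), AlmostHasInvVec π ∧
        ∀ ξ η : H, Tendsto (fun g => ⟪η, π.toHom g ξ⟫_ℂ) (comap ψ atTop) (𝓝 0) := by
  let s : ℕ → ℝ := fun n => 1 / ((n : ℝ) + 1)
  have hspos : ∀ n, 0 < s n := fun n => by positivity
  let M : Matrix (Σ _ : ℕ, G) (Σ _ : ℕ, G) ℂ := (expKernel ψ s).map (↑)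
  have hM : ∀ n m a b, M ⟨n, a⟩ ⟨m, b⟩ =
      if n = m then ((Real.exp (-(s n ^ 2 * ψ (a⁻¹ * b))) : ℝ) : ℂ) else 0 := fun n m a b => by
    simp only [M, expKernel, Matrix.map_apply, Matrix.of_apply]
    split_ifs <;> rfl
  obtain ⟨H, i1, i2, i3, e, π, he, hin, hπ, hπc⟩ := exists_representation_of_kernel (G := G)
    (M := M) (posSemidef_ofReal (posSemidef_expKernel h s))
    (by rintro g ⟨n, a⟩ ⟨m, b⟩; simp [hM, mul_assoc])
    (by
      rintro ⟨n, a⟩ ⟨m, b⟩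
      simp only [Sigma.smul_mk, hM, smul_eq_mul]
      split_ifs
      · fun_prop
      · exact continuous_const)
  refine ⟨H, i1, i2, i3, ⟨π, hπc⟩, fun K hK δ hδ => ?_, ?_⟩
  · obtain ⟨B, hB⟩ := hK.exists_bound_of_continuousOn hcont.continuousOn
    have hlim : Tendsto (fun n => 2 * (s n ^ 2 * B)) atTop (𝓝 (2 * (0 ^ 2 * B))) :=
      ((tendsto_one_div_add_atTop_nhds_zero_nat.pow 2).mul_const B).const_mul 2
    have hlt : 2 * (0 ^ 2 * B) < δ ^ 2 := by
      have : 0 < δ ^ 2 := by positivity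
      simpa using this
    obtain ⟨n, hn⟩ := (hlim.eventually (gt_mem_nhds hlt)).exists
    have hnorm : ‖e ⟨n, 1⟩‖ = 1 := by
      have := hin ⟨n, 1⟩ ⟨n, 1⟩
      rw [hM, if_pos rfl, inv_one, mul_one, h.map_one, inner_self_eq_norm_sq_to_K] at this
      simp only [mul_zero, neg_zero, Real.exp_zero] at this
      have h2 : ‖e ⟨n, 1⟩‖ ^ 2 = 1 := by
        rw [← RCLike.ofReal_pow] at this
        exact Complex.ofReal_injective this
      exact (pow_eq_one_iff_of_nonneg (norm_nonneg _) two_ne_zero).1 h2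
    refine ⟨e ⟨n, 1⟩, norm_ne_zero_iff.1 (by rw [hnorm]; exact one_ne_zero), fun g hg => ?_⟩
    rw [hnorm, mul_one]
    refine (abs_le_of_sq_le_sq' ?_ hδ.le).2
    rw [UnitaryRep.norm_sub_sq ⟨π, hπc⟩, hnorm]
    simp only [hπ, Sigma.smul_mk, hin, hM, if_true, smul_eq_mul, mul_one, inv_one, one_mul,
      Complex.ofReal_re]
    have h1 := Real.add_one_le_exp (-(s n ^ 2 * ψ g))
    have h2 : s n ^ 2 * ψ g ≤ s n ^ 2 * B := by
      gcongr
      exact (le_abs_self _).trans (hB g hg)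
    linarith
  · have hbasic : ∀ x y, Tendsto (fun g => ⟪e y, π g (e x)⟫_ℂ) (comap ψ atTop) (𝓝 0) := by
      rintro ⟨n, a⟩ ⟨m, b⟩
      simp only [hπ, Sigma.smul_mk, hin, hM, smul_eq_mul]
      split_ifs
      -- `ψ` is a quasi-length, so translating by fixed elements does not affect `ψ g → ∞`
      · have hle : ∀ g, (ψ g - (2 * ψ b + 4 * ψ a)) / 4 ≤ ψ (b⁻¹ * (g * a)) := fun g => by
          have h1 := h.le_two_mul_add b (b⁻¹ * g)
          have h2 := h.le_two_mul_add (b⁻¹ * (g * a)) a⁻¹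
          rw [← h.map_inv a] at h2
          simp only [mul_inv_cancel_left, mul_assoc, mul_inv_cancel, mul_one] at h1 h2
          linarith
        have h3 : Tendsto (fun g => ψ (b⁻¹ * (g * a))) (comap ψ atTop) atTop :=
          tendsto_atTop_mono hle
            ((tendsto_atTop_add_const_right _ _ tendsto_comap).atTop_div_const (by norm_num))
        have h4 := Real.tendsto_exp_neg_atTop_nhds_zero.comp
          (h3.const_mul_atTop (pow_pos (hspos m) 2))
        exact_mod_cast (Complex.continuous_ofReal.tendsto 0).comp h4
      · exact tendsto_const_nhds
    -- pass from the total family to all vectors, one variable at a time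
    have hhalf : ∀ ξ y, Tendsto (fun g => ⟪e y, π g ξ⟫_ℂ) (comap ψ atTop) (𝓝 0) := fun ξ y =>
      tendsto_zero_of_total he
        (fun g => (innerSL ℂ (e y)).toLinearMap ∘ₗ (π g).toLinearEquiv.toLinearMap) ‖e y‖
        (fun g ξ => (norm_inner_le_norm _ _).trans_eq (by simp)) (fun x => hbasic x y) ξ
    intro ξ η
    have := tendsto_zero_of_total he
      (fun g => (innerSL ℂ (π g ξ)).toLinearMap) ‖ξ‖
      (fun g η => (norm_inner_le_norm _ _).trans_eq (by simp)) (l := comap ψ atTop)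
      (fun y => by
        rw [tendsto_zero_iff_norm_tendsto_zero]
        simpa [norm_inner_symm] using (hhalf ξ y).norm) η
    rw [tendsto_zero_iff_norm_tendsto_zero] at this ⊢
    simpa [norm_inner_symm] using this

theorem AlmostInvImpliesInv.relPropFH [IsTopologicalGroup G] {ε : ℝ} (hε : 0 ≤ ε)
    (hε2 : ε < Real.sqrt 2) (hX : AlmostInvImpliesInv G X ε) : RelPropFH G X := by
  intro ψ hcont hψ
  by_contra! hcon
  obtain ⟨H, _, _, _, π, hπ, hlim⟩ := hψ.exists_unitaryRep hcont
  obtain ⟨ξ, hξ1, hξ⟩ := (hX H π hπ).exists_unit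
  have hε3 : ε ^ 2 < 2 := by
    have := pow_lt_pow_left₀ hε2 hε two_ne_zero
    rwa [Real.sq_sqrt (by norm_num)] at this
  have hpos : (0 : ℂ).re < 1 - ε ^ 2 / 2 := by rw [Complex.zero_re]; linarith
  have h1 := ((Complex.continuous_re.tendsto 0).comp (hlim ξ ξ)).eventually (gt_mem_nhds hpos)
  rw [eventually_comap] at h1
  obtain ⟨R, hR⟩ := eventually_atTop.1 h1
  obtain ⟨g, hg, hgR⟩ := hcon R
  rw [abs_of_nonneg (hψ.nonneg g)] at hgR
  have h2 := hR _ hgR.le g rfl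
  have h3 := pow_le_pow_left₀ (norm_nonneg _) (hξ g hg) 2
  rw [π.norm_sub_sq, hξ1] at h3
  simp only [Function.comp_apply] at h2
  linarith

end FH

/-! ### Affine isometric actions -/

section Affine

variable {X : Set G}

/-- Every continuous conditionally negative definite function is the squared displacement of the
origin under a continuous affine isometric action. -/
theorem IsCondNegDefFun.exists_affine_action [IsTopologicalGroup G] {ψ : G → ℝ}
    (h : IsCondNegDefFun ψ) (hcont : Continuous ψ) :
    ∃ (V : Type u) (_ : NormedAddCommGroup V) (_ : InnerProductSpace ℝ V) (_ : CompleteSpace V)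
      (α : G →* (V ≃ᵃⁱ[ℝ] V)), (∀ v, Continuous fun g => α g v) ∧ ∀ g, ‖α g 0‖ ^ 2 = ψ g := by
  obtain ⟨V, i1, i2, i3, e, π, he, hin, hπ, hπc⟩ := exists_representation_of_kernel (G := G)
    (posSemidef_pairKernel h)
    (by rintro g ⟨a, a'⟩ ⟨b, b'⟩; simp [pairKernel, mul_assoc])
    (by
      rintro ⟨a, a'⟩ ⟨b, b'⟩
      simp only [pairKernel, Prod.smul_mk, Matrix.of_apply, smul_eq_mul]
      fun_prop)
  -- `e (a, c)` is a formal difference `b a - b c`; both sides have equal inner products with `e`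
  have hadd : ∀ a b c, e (a, c) = e (a, b) + e (b, c) := fun a b c => by
    have : ∀ x : G × G, ⟪e x, e (a, c)⟫_ℝ = ⟪e x, e (a, b) + e (b, c)⟫_ℝ := fun x => by
      rw [inner_add_right, hin, hin, hin]
      simp only [pairKernel, Matrix.of_apply]
      ring
    refine he.eq_of_inner_right ℝ fun y hy => ?_
    induction hy using Submodule.span_induction with
    | mem y hy => obtain ⟨x, rfl⟩ := hy; exact this x
    | zero => simp
    | add p q _ _ hp hq => rw [inner_add_left, inner_add_left, hp, hq]
    | smul r p _ hp => rw [inner_smul_left, inner_smul_left, hp]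
  let b : G → V := fun g => e (g, 1)
  have hb : ∀ g k, b (g * k) = b g + π g (b k) := fun g k => by
    simp only [b, hπ, Prod.smul_mk, smul_eq_mul, mul_one]
    rw [hadd (g * k) g 1, add_comm]
  have hbn : ∀ g k, ‖b g - b k‖ ^ 2 = ψ (g⁻¹ * k) := fun g k => by
    have : b g - b k = e (g, k) := by simp only [b]; rw [hadd g k 1]; abel
    rw [this, ← real_inner_self_eq_norm_sq, hin]
    simp only [pairKernel, Matrix.of_apply, inv_mul_cancel, h.map_one, h.map_inv_mul_comm k g]
    ring
  have hb1 : b 1 = 0 := by simpa using hb 1 1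
  have hbc : Continuous b := by
    rw [continuous_iff_continuousAt]
    intro g₀
    rw [ContinuousAt, tendsto_iff_norm_sub_tendsto_zero]
    have h1 : Continuous fun g => Real.sqrt (ψ (g⁻¹ * g₀)) := by fun_prop
    have h2 := h1.tendsto g₀
    rw [inv_mul_cancel, h.map_one, Real.sqrt_zero] at h2
    refine h2.congr fun g => ?_
    rw [← hbn, Real.sqrt_sq (norm_nonneg _)]
  let A : G → (V ≃ᵃⁱ[ℝ] V) := fun g =>
    (π g).toAffineIsometryEquiv.trans (AffineIsometryEquiv.constVAdd ℝ V (b g))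
  have hA : ∀ g v, A g v = b g + π g v := fun g v => rfl
  let α : G →* (V ≃ᵃⁱ[ℝ] V) :=
    { toFun := A
      map_one' := by ext v; simp [hA, hb1]
      map_mul' := fun g k => by
        ext v
        simp [hA, hb, add_assoc] }
  refine ⟨V, i1, i2, i3, α, fun v => ?_, fun g => ?_⟩
  · exact hbc.add (hπc v)
  · have h1 : α g 0 = b g := by
      change A g 0 = b g
      rw [hA, map_zero, add_zero]
    have h2 := hbn g 1
    rw [hb1, sub_zero, mul_one, ← h.map_inv] at h2
    rw [h1, h2]

theorem relPropFH_iff_relPropFHAffine [IsTopologicalGroup G] :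
    RelPropFH G X ↔ RelPropFHAffine G X := by
  constructor
  · intro h V P _ _ _ _ _ α hα v
    obtain ⟨M, hM⟩ := h (fun g => dist (α g v) v ^ 2) (((hα v).dist continuous_const).pow 2)
      (isCondNegDefFun_dist_sq α v)
    refine (Metric.isBounded_closedBall (x := v) (r := Real.sqrt M)).subset ?_
    rintro _ ⟨g, hg, rfl⟩
    exact Real.le_sqrt_of_sq_le ((le_abs_self _).trans (hM g hg))
  · intro h ψ hcont hψ
    obtain ⟨V, _, _, _, α, hα, hαψ⟩ := hψ.exists_affine_action hcont
    obtain ⟨R, hR⟩ := (h V V α hα 0).exists_norm_le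
    refine ⟨R ^ 2, fun g hg => ?_⟩
    rw [abs_of_nonneg (hψ.nonneg g), ← hαψ]
    exact pow_le_pow_left₀ (norm_nonneg _) (hR _ ⟨g, hg, rfl⟩) 2

end Affine

/-! ### From (FH) to (T) for `σ`-compact groups -/

section SigmaCompact

variable {X : Set G}

/-- Given a net `φ` contradicting relative Property (T), choose `φ_n` within `4⁻ⁿ` of `1` on the
`n`-th compact set of an exhaustion; then `∑ 2ⁿ (1 - Re φ_n)` is unbounded on `X`. -/
theorem RelPropFH.relPropT [WeaklyLocallyCompactSpace G] [SigmaCompactSpace G]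
    (hX : RelPropFH G X) : RelPropT G X := by
  intro ι _ _ _ φ hφ hK
  by_contra hcon
  rw [Metric.tendstoUniformlyOn_iff] at hcon
  push Not at hcon
  obtain ⟨ε, hε, hfreq⟩ := hcon
  let K : CompactExhaustion G := default
  have hex : ∀ n : ℕ, ∃ i, (∀ g ∈ K n, ‖φ i g - 1‖ < (1 / 4) ^ n) ∧
      ∃ g ∈ X, ε ≤ ‖φ i g - 1‖ := fun n => by
    have h1 := (Metric.tendstoUniformlyOn_iff.1 (hK (K n) (K.isCompact n))) ((1 / 4) ^ n)
      (by positivity)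
    obtain ⟨i, ⟨g, hg, hgε⟩, hi⟩ := (hfreq.and_eventually h1).exists
    refine ⟨i, fun g hg => ?_, g, hg, ?_⟩
    · rw [← dist_eq_norm, dist_comm]; exact hi g hg
    · rwa [← dist_eq_norm, dist_comm]
  choose i hiK x hxX hxε using hex
  let f : ℕ → G → ℝ := fun n g => 2 ^ n * (1 - (φ (i n) g).re)
  have hfcnd : ∀ n, IsCondNegDefFun (f n) := fun n =>
    ((hφ (i n)).2.1.isCondNegDefFun (hφ (i n)).2.2).const_mul (by positivity)
  have hfcont : ∀ n, Continuous (f n) := fun n =>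
    (continuous_const.sub (Complex.continuous_re.comp (hφ (i n)).1)).const_smul ((2 : ℝ) ^ n)
  have hf0 : ∀ n g, 0 ≤ f n g := fun n g => (hfcnd n).nonneg g
  have hre : ∀ n g, 1 - (φ (i n) g).re ≤ ‖φ (i n) g - 1‖ := fun n g => by
    have := (neg_le_abs _).trans (Complex.abs_re_le_norm (φ (i n) g - 1))
    simp only [Complex.sub_re, Complex.one_re] at this
    linarith
  -- on the `m`-th compact set, only the terms of index `n < m` escape the geometric bound
  let u : ℕ → ℕ → ℝ := fun m n => if n < m then 2 ^ n * 2 else (1 / 2) ^ n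
  have hu : ∀ m, Summable (u m) := fun m => by
    refine (summable_congr_atTop ?_).1 (summable_geometric_two)
    filter_upwards [eventually_ge_atTop m] with n hn
    simp [u, hn.not_gt]
  have hfu : ∀ m n, ∀ g ∈ K m, ‖f n g‖ ≤ u m n := fun m n g hg => by
    rw [Real.norm_of_nonneg (hf0 n g)]
    simp only [f, u]
    split_ifs with hnm
    · gcongr
      refine (hre n g).trans ((norm_sub_le _ _).trans ?_)
      have := (hφ (i n)).2.1.norm_le_one (hφ (i n)).2.2 g
      rw [norm_one]; linarith
    · have h1 := (hre n g).trans (hiK n g (K.subset (not_lt.1 hnm) hg)).le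
      calc (2 : ℝ) ^ n * (1 - (φ (i n) g).re) ≤ 2 ^ n * (1 / 4) ^ n := by gcongr
        _ = (1 / 2) ^ n := by rw [← mul_pow]; norm_num
  have hsum : ∀ g, Summable fun n => f n g := fun g => by
    obtain ⟨m, hm⟩ := K.exists_mem g
    exact Summable.of_norm_bounded (hu m) fun n => hfu m n g hm
  have hψcont : Continuous fun g => ∑' n, f n g := by
    rw [continuous_iff_continuousAt]
    intro g
    obtain ⟨m, hm⟩ := K.exists_mem_nhds g
    exact (continuousOn_tsum (fun n => (hfcont n).continuousOn) (hu m) (hfu m)).continuousAt hm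
  obtain ⟨R, hR⟩ := hX _ hψcont (IsCondNegDefFun.of_hasSum hfcnd fun g => (hsum g).hasSum)
  obtain ⟨n, hn⟩ := pow_unbounded_of_one_lt (R / (ε ^ 2 / 2)) (one_lt_two (α := ℝ))
  rw [div_lt_iff₀ (by positivity)] at hn
  have h1 : f n (x n) ≤ R := ((hsum (x n)).le_tsum n fun m _ => hf0 m _).trans
    ((le_abs_self _).trans (hR (x n) (hxX n)))
  have h2 := (hφ (i n)).2.1.norm_sub_one_sq_le (hφ (i n)).2.2 (x n)
  have h3 := pow_le_pow_left₀ hε.le (hxε n) 2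
  have h4 : (2 : ℝ) ^ n * (ε ^ 2 / 2) ≤ f n (x n) := by
    simp only [f]; gcongr; linarith
  linarith

end SigmaCompact

theorem HasCompactKazhdanSubset.almostInvImpliesInv {X : Set G} {ε : ℝ}
    (h : HasCompactKazhdanSubset G X ε) : AlmostInvImpliesInv G X ε := by
  obtain ⟨K, hK, η, hη, hpair⟩ := h
  exact fun H _ _ _ π hπ => hpair H π (hπ K hK η hη)

end RelKazhdan

theorem theorem2 (G : Type u) [Group G] [TopologicalSpace G] [IsTopologicalGroup G]
    [LocallyCompactSpace G] (X : Set G) :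
    -- (1) => (2)
    (RelKazhdan.RelPropT G X →
      ∀ ε : ℝ, 0 < ε → RelKazhdan.HasCompactKazhdanSubset G X ε) ∧
    -- (2) => (2')
    ((∀ ε : ℝ, 0 < ε → RelKazhdan.HasCompactKazhdanSubset G X ε) →
      ∃ ε : ℝ, 0 < ε ∧ ε < Real.sqrt 2 ∧ RelKazhdan.HasCompactKazhdanSubset G X ε) ∧
    -- (2) => (3)
    ((∀ ε : ℝ, 0 < ε → RelKazhdan.HasCompactKazhdanSubset G X ε) →
      ∀ ε : ℝ, 0 < ε → RelKazhdan.AlmostInvImpliesInv G X ε) ∧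
    -- (2') => (3')
    ((∃ ε : ℝ, 0 < ε ∧ ε < Real.sqrt 2 ∧ RelKazhdan.HasCompactKazhdanSubset G X ε) →
      ∃ ε : ℝ, 0 ≤ ε ∧ ε < Real.sqrt 2 ∧ RelKazhdan.AlmostInvImpliesInv G X ε) ∧
    -- (3) => (3')
    ((∀ ε : ℝ, 0 < ε → RelKazhdan.AlmostInvImpliesInv G X ε) →
      ∃ ε : ℝ, 0 ≤ ε ∧ ε < Real.sqrt 2 ∧ RelKazhdan.AlmostInvImpliesInv G X ε) ∧
    -- (3') => (4)
    ((∃ ε : ℝ, 0 ≤ ε ∧ ε < Real.sqrt 2 ∧ RelKazhdan.AlmostInvImpliesInv G X ε) →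
      RelKazhdan.RelPropFH G X) ∧
    -- the two formulations of (4) agree
    (RelKazhdan.RelPropFH G X ↔ RelKazhdan.RelPropFHAffine G X) ∧
    -- all conditions are equivalent when `G` is σ-compact
    (SigmaCompactSpace G →
      [RelKazhdan.RelPropT G X,
        ∀ ε : ℝ, 0 < ε → RelKazhdan.HasCompactKazhdanSubset G X ε,
        ∃ ε : ℝ, 0 < ε ∧ ε < Real.sqrt 2 ∧ RelKazhdan.HasCompactKazhdanSubset G X ε,
        ∀ ε : ℝ, 0 < ε → RelKazhdan.AlmostInvImpliesInv G X ε,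
        ∃ ε : ℝ, 0 ≤ ε ∧ ε < Real.sqrt 2 ∧ RelKazhdan.AlmostInvImpliesInv G X ε,
        RelKazhdan.RelPropFH G X,
        RelKazhdan.RelPropFHAffine G X].TFAE) := by
  have hone : (1 : ℝ) < Real.sqrt 2 := Real.lt_sqrt_of_sq_lt (by norm_num)
  have h12 : RelKazhdan.RelPropT G X →
      ∀ ε : ℝ, 0 < ε → RelKazhdan.HasCompactKazhdanSubset G X ε :=
    fun h _ hε => h.hasCompactKazhdanSubset hε
  have h22' : (∀ ε : ℝ, 0 < ε → RelKazhdan.HasCompactKazhdanSubset G X ε) →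
      ∃ ε : ℝ, 0 < ε ∧ ε < Real.sqrt 2 ∧ RelKazhdan.HasCompactKazhdanSubset G X ε :=
    fun h => ⟨1, one_pos, hone, h 1 one_pos⟩
  have h23 : (∀ ε : ℝ, 0 < ε → RelKazhdan.HasCompactKazhdanSubset G X ε) →
      ∀ ε : ℝ, 0 < ε → RelKazhdan.AlmostInvImpliesInv G X ε :=
    fun h ε hε => (h ε hε).almostInvImpliesInv
  have h2'3' : (∃ ε : ℝ, 0 < ε ∧ ε < Real.sqrt 2 ∧ RelKazhdan.HasCompactKazhdanSubset G X ε) →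
      ∃ ε : ℝ, 0 ≤ ε ∧ ε < Real.sqrt 2 ∧ RelKazhdan.AlmostInvImpliesInv G X ε :=
    fun ⟨ε, h0, h2, h⟩ => ⟨ε, h0.le, h2, h.almostInvImpliesInv⟩
  have h33' : (∀ ε : ℝ, 0 < ε → RelKazhdan.AlmostInvImpliesInv G X ε) →
      ∃ ε : ℝ, 0 ≤ ε ∧ ε < Real.sqrt 2 ∧ RelKazhdan.AlmostInvImpliesInv G X ε :=
    fun h => ⟨1, zero_le_one, hone, h 1 one_pos⟩
  have h3'4 : (∃ ε : ℝ, 0 ≤ ε ∧ ε < Real.sqrt 2 ∧ RelKazhdan.AlmostInvImpliesInv G X ε) →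
      RelKazhdan.RelPropFH G X :=
    fun ⟨_, h0, h2, h⟩ => h.relPropFH h0 h2
  have h44 := RelKazhdan.relPropFH_iff_relPropFHAffine (G := G) (X := X)
  refine ⟨h12, h22', h23, h2'3', h33', h3'4, h44, fun _ => ?_⟩
  tfae_have 1 → 2 := h12
  tfae_have 2 → 3 := h22'
  tfae_have 2 → 4 := h23
  tfae_have 3 → 5 := h2'3'
  tfae_have 4 → 5 := h33'
  tfae_have 5 → 6 := h3'4
  tfae_have 6 ↔ 7 := h44
  tfae_have 6 → 1 := fun h => h.relPropT
  tfae_finish
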